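/- Let $A$ be a finite nonempty alphabet, $m\ge 1$, and $\|\mathbf v\|=\sum_i|\mathbf v(i)|$ for row vectors $\mathbf v\in\mathbb R^m$. Let $(\mathbf M_a)_{a\in A}$ be $m\times m$ matrices with nonnegative real entries; for a word $w=a_1\cdots a_k$ put $\mathbf M_w=\mathbf M_{a_1}\cdots\mathbf M_{a_k}$ (the identity for the empty word). Assume that the family is superfair, i.e. $\frac1{|A|}\sum_{a\in A}\|\mathbf v\mathbf M_a\|\le\|\mathbf v\|$ for every $\mathbf v\in\mathbb R^m_{\ge0}$, and that $(\bigstar)$ for all $i,j\in\{1,\dots,m\}$ there is a word $w$ with $\mathbf M_w(i,j)>0$. For $\mathbf v\in\mathbb R_{\ge0}^m$ let $\mathbf v\cdot w=\mathbf v\mathbf M_w/\|\mathbf v\mathbf M_w\|$ if $\mathbf v\mathbf M_w\ne\mathbf 0$, and $\mathbf v\cdot w=\mathbf 0$ otherwise. For $E\subseteq\{1,\dots,m\}$ let $E\cdot w=\{j:\mathbf M_w(i,j)>0\text{ for some }i\in E\}$, which is the support of $\mathbf v\mathbf M_w$ for every nonnegative $\mathbf v$ of support $E$. A word $w$ pseudo-mixes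 $E$ if $E\cdot w=E$ and, for every $i\in E$, $\{i\}\cdot w$ is $E$ or $\emptyset$. For nonzero $\mathbf u\in\mathbb R^m_{\ge0}$ put $$\Delta(\mathbf u)=\min\Bigl(1,\ \ln\|\mathbf u\|-\frac1{|A|}\sum_{a\in A}\ln\|\mathbf u\mathbf M_a\|\Bigr),\qquad \ln 0=-\infty .$$ Consider the deterministic automaton whose states are the sets reachable from singletons, i.e. the sets $\{i\}\cdot w$, with transitions $E\xrightarrow{a}E\cdot a$. Let $\mathfrak B$ be a bottom strongly connected component of it with $\mathfrak B\neq\{\emptyset\}$, let $F\in\mathfrak B$, let $w$ be a word that pseudo-mixes $F$, and let $\mathbf x$ be the fixed point attached to $w$: the nonnegative vector of norm $1$ and support exactly $F$ with $\mathbf x\cdot w=\mathbf x$. Assume that $\Delta(\mathbf x\cdot z)>0$ for some word $z$. Call $X\in A^{\mathbb N}$ normal if every word $u$ occurs in $X$ with asymptotic frequency $|A|^{-|u|}$, and write $X[1..n]$ for the word of the first $n$ letters of $X$. Then for every normal $X$ and every $\mathbf v\in\mathbb R^m_{\ge0}$, either 1. $\mathbf v\mathbf M_{X[1..n]}=\mathbf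 0$ for all sufficiently large $n$, or 2. $\|\mathbf v\mathbf M_{X[1..n]}\|>0$ for all $n$ and $\|\mathbf v\mathbf M_{X[1..n]}\|=O(e^{-\alpha n})$ for some $\alpha>0$. Moreover, there is a $\mathbf v\in\mathbb R^m_{\ge0}$ for which the second alternative holds for every normal $X$. -/

import Mathlib

open Filter Topology Asymptotics Matrix

noncomputable section

namespace MatFam

variable {A : Type*} {m : ℕ}

/-- The norm `∑ i, |v i|` of a (row) vector. -/
def norm1 (v : Fin m → ℝ) : ℝ := ∑ i, |v i|

/-- The support of a nonnegative vector. -/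
def supp (v : Fin m → ℝ) : Set (Fin m) := {i | 0 < v i}

/-- The nonnegative vectors of norm `1` whose support is exactly `E`. -/
def unitVectors (E : Set (Fin m)) : Set (Fin m → ℝ) :=
  {v | 0 ≤ v ∧ norm1 v = 1 ∧ supp v = E}

/-- `M_w = M_{a₁} ⋯ M_{aₖ}` for a word `w = a₁ ⋯ aₖ`; the identity matrix for the empty word. -/
def wordMat (M : A → Matrix (Fin m) (Fin m) ℝ) (w : List A) : Matrix (Fin m) (Fin m) ℝ :=
  (w.map M).prod

/-- A family of matrices with nonnegative entries. -/
def IsNonneg (M : A → Matrix (Fin m) (Fin m) ℝ) : Prop :=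
  ∀ a i j, 0 ≤ M a i j

/-- A superfair family: the average over the letters of `‖v M_a‖` is at most `‖v‖`, for every
nonnegative vector `v`. -/
def IsSuperfair [Fintype A] (M : A → Matrix (Fin m) (Fin m) ℝ) : Prop :=
  ∀ v : Fin m → ℝ, 0 ≤ v → (∑ a, norm1 (v ᵥ* M a)) / Fintype.card A ≤ norm1 v

/-- Condition (★): every index can be reached from every index along some word. -/
def IsStar (M : A → Matrix (Fin m) (Fin m) ℝ) : Prop :=
  ∀ i j, ∃ w : List A, 0 < wordMat M w i j

/-- The action of words on directions: `v · w = v M_w / ‖v M_w‖`, and `v · w = 0` if `v M_w = 0`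
(in that case the formula below evaluates to `0⁻¹ • 0 = 0`). -/
def dirAct (M : A → Matrix (Fin m) (Fin m) ℝ) (v : Fin m → ℝ) (w : List A) : Fin m → ℝ :=
  (norm1 (v ᵥ* wordMat M w))⁻¹ • (v ᵥ* wordMat M w)

open Classical in
/-- The bounded risk measure
`Δ(u) = min (1, ln ‖u‖ - (1/|A|) ∑ a, ln ‖u M_a‖)` of a nonzero nonnegative vector `u`, with
`ln 0 = -∞`: if some `u M_a` vanishes, the second term is `+∞` and the minimum is `1`. -/
def risk [Fintype A] (M : A → Matrix (Fin m) (Fin m) ℝ) (u : Fin m → ℝ) : ℝ :=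
  if ∃ a, u ᵥ* M a = 0 then 1
  else min 1 (Real.log (norm1 u) - (∑ a, Real.log (norm1 (u ᵥ* M a))) / Fintype.card A)

/-- The action of words on subsets of `{1, …, m}`: `E · w` is the support of `v M_w` for any
nonnegative vector `v` of support `E` (see `supp_vecMul_wordMat`). -/
def setAct (M : A → Matrix (Fin m) (Fin m) ℝ) (E : Set (Fin m)) (w : List A) : Set (Fin m) :=
  {j | ∃ i ∈ E, 0 < wordMat M w i j}

lemma wordMat_nonneg {M : A → Matrix (Fin m) (Fin m) ℝ} (hM : IsNonneg M) (w : List A)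
    (i j : Fin m) : 0 ≤ wordMat M w i j := by
  induction w generalizing i j with
  | nil =>
    simp only [wordMat, List.map_nil, List.prod_nil, Matrix.one_apply]
    split_ifs <;> norm_num
  | cons a w ih =>
    simp only [wordMat, List.map_cons, List.prod_cons, Matrix.mul_apply]
    exact Finset.sum_nonneg fun k _ => mul_nonneg (hM a i k) (ih k j)

lemma supp_vecMul_wordMat {M : A → Matrix (Fin m) (Fin m) ℝ} (hM : IsNonneg M)
    {v : Fin m → ℝ} (hv : 0 ≤ v) (w : List A) :
    supp (v ᵥ* wordMat M w) = setAct M (supp v) w := by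
  ext j
  have h0 : ∀ i ∈ Finset.univ, 0 ≤ v i * wordMat M w i j :=
    fun i _ => mul_nonneg (hv i) (wordMat_nonneg hM w i j)
  simp only [supp, setAct, Set.mem_ofPred_eq, Matrix.vecMul, dotProduct]
  rw [Finset.sum_pos_iff_of_nonneg h0]
  constructor
  · rintro ⟨i, -, hi⟩
    have h1 : v i ≠ 0 := fun h => by simp [h] at hi
    have h2 : wordMat M w i j ≠ 0 := fun h => by simp [h] at hi
    exact ⟨i, lt_of_le_of_ne (hv i) h1.symm,
      lt_of_le_of_ne (wordMat_nonneg hM w i j) h2.symm⟩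
  · rintro ⟨i, h1, h2⟩
    exact ⟨i, Finset.mem_univ i, mul_pos h1 h2⟩

/-- `w` pseudo-mixes `E`: it stabilizes `E`, and every `i ∈ E` is sent to `E` or to `∅`. -/
def PseudoMixes (M : A → Matrix (Fin m) (Fin m) ℝ) (w : List A) (E : Set (Fin m)) : Prop :=
  setAct M E w = E ∧ ∀ i ∈ E, setAct M {i} w = E ∨ setAct M {i} w = ∅

/-- `B` is a bottom strongly connected component of the deterministic automaton with transition
function `δ` restricted to the `δ`-closed set of states `Q`. -/
structure IsBSCC {S : Type*} (δ : S → A → S) (Q B : Set S) : Prop where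
  subset : B ⊆ Q
  nonempty : B.Nonempty
  connected : ∀ s ∈ B, ∀ t ∈ B, ∃ w : List A, w.foldl δ s = t
  bottom : ∀ s ∈ B, ∀ a, δ s a ∈ B

/-- The transition function `E ↦ E · a` of the support automaton, with set of states the power
set of `{1, …, m}`. -/
def supportStep (M : A → Matrix (Fin m) (Fin m) ℝ) (E : Set (Fin m)) (a : A) : Set (Fin m) :=
  setAct M E [a]

/-- The states of the support automaton that are reachable from singletons. -/
def reachableStates (M : A → Matrix (Fin m) (Fin m) ℝ) : Set (Set (Fin m)) :=
  {E | ∃ (i : Fin m) (w : List A), w.foldl (supportStep M) {i} = E}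

/-- A non-null (that is, other than `{∅}`) bottom strongly connected component of the support
automaton restricted to the states reachable from singletons. -/
def IsNonNullBSCC (M : A → Matrix (Fin m) (Fin m) ℝ) (B : Set (Set (Fin m))) : Prop :=
  IsBSCC (supportStep M) (reachableStates M) B ∧ B ≠ {∅}

/-- `x` is the fixed point attached to the word `w` pseudo-mixing `F`: the unit vector of
support `F` with `x · w = x`. -/
def IsFixedDirection (M : A → Matrix (Fin m) (Fin m) ℝ) (F : Set (Fin m)) (w : List A)
    (x : Fin m → ℝ) : Prop :=
  x ∈ unitVectors F ∧ dirAct M x w = x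

/-- The word formed by the `l` consecutive letters of `X` from position `i` on (positions are
counted from `0`). -/
def subword (X : ℕ → A) (i l : ℕ) : List A := List.ofFn fun j : Fin l => X (i + j)

open Classical in
/-- `X` is normal: every word `u` occurs in `X` with frequency `|A|^(-|u|)`. -/
def IsNormal [Fintype A] (X : ℕ → A) : Prop :=
  ∀ u : List A, Tendsto
    (fun n : ℕ => (((Finset.range n).filter fun i => subword X i u.length = u).card : ℝ) / n)
    atTop (𝓝 (1 / (Fintype.card A : ℝ) ^ u.length))

/-- The vector `v M_{X[1..n]}`. -/
def orbit (M : A → Matrix (Fin m) (Fin m) ℝ) (X : ℕ → A) (v : Fin m → ℝ) (n : ℕ) :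
    Fin m → ℝ :=
  v ᵥ* wordMat M (subword X 0 n)

/-- The real sequence `s` converges exponentially fast to `l`. -/
def ConvergesExpFast (s : ℕ → ℝ) (l : ℝ) : Prop :=
  ∃ α : ℝ, 0 < α ∧ (fun n => s n - l) =O[atTop] fun n : ℕ => Real.exp (-α * n)

end MatFam

end

open MatFam

/-!
The proof replaces the dynamics on directions by a statement about the mean growth rate of the
matrix products. Write `N(W)` for the sum of the row norms of `W` (`rowNormSum`). If the mean of
`ln N(M_u)` over the words `u` of some length `L` is negative, then every orbit along a normal
sequence that avoids `0` decays exponentially: `s n = ln ‖v M_{X[1..n]}‖` satisfies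
`s (n + L) - s n ≤ ln N(M_u)`, where `u` is the block of `X` at position `n`; summing over `n`
telescopes on the left and averages over all blocks, by normality, on the right
(`exists_eventually_le_of_average_neg`, `convergesExpFast_orbit`).

The mean of the logarithm is bounded by a square-root moment, `ln t ≤ 2 (√t - 1)`. By Jensen's
inequality and superfairness the mean of `√‖v M_u‖` over the words of length `n` (`sqrtMean`) is
nonincreasing in `n`; it is constant in `n` only for a *conservative* vector, one with
`‖v M_u‖ = ‖v‖` for all words `u` (`isConservative_of_sqrt_le_sqrtMean`). If no nonzero nonnegative
vector is conservative, compactness of the simplex gives a uniform contraction at some length,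
hence exponential decay of the moments (`exists_sqrtMean_le_mul_sqrt`).

Positive risk on the orbit of the fixed direction `x` excludes conservative vectors
(`not_isConservative_of_risk_pos`). By (★), a conservative vector has an image which dominates a
multiple of `x`. So the orbit of `x` is bounded and fair at every step, and a vector of
maximal norm in its closure is conservative (`exists_isConservative_mem_closure`); moving it along
a word, one gets a conservative vector supported in `F`. Pseudo-mixing then forces `x` itself to
be conservative (`IsFixedDirection.isConservative`), which makes the risk vanish along its orbit.

Finally, `x` has its support in a non-null bottom component, so that its orbit never meets `0`.
-/

open MatFam

namespace MatFam

variable {A : Type*} {m : ℕ}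

/-! ### The norm on nonnegative vectors -/

lemma norm1_eq_sum {v : Fin m → ℝ} (hv : 0 ≤ v) : norm1 v = ∑ i, v i :=
  Finset.sum_congr rfl fun i _ => abs_of_nonneg (hv i)

lemma norm1_nonneg (v : Fin m → ℝ) : 0 ≤ norm1 v :=
  Finset.sum_nonneg fun _ _ => abs_nonneg _

lemma norm1_eq_zero_iff {v : Fin m → ℝ} : norm1 v = 0 ↔ v = 0 := by
  rw [norm1, Finset.sum_eq_zero_iff_of_nonneg fun _ _ => abs_nonneg _]
  simp [funext_iff]

lemma norm1_pos {v : Fin m → ℝ} (hv : v ≠ 0) : 0 < norm1 v :=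
  (norm1_nonneg v).lt_of_ne' (mt norm1_eq_zero_iff.1 hv)

lemma norm1_add {v w : Fin m → ℝ} (hv : 0 ≤ v) (hw : 0 ≤ w) :
    norm1 (v + w) = norm1 v + norm1 w := by
  rw [norm1_eq_sum hv, norm1_eq_sum hw, norm1_eq_sum (add_nonneg hv hw)]
  simp [Finset.sum_add_distrib]

lemma norm1_smul {c : ℝ} (hc : 0 ≤ c) (v : Fin m → ℝ) : norm1 (c • v) = c * norm1 v := by
  simp [norm1, abs_mul, abs_of_nonneg hc, Finset.mul_sum]

lemma norm1_mono {v w : Fin m → ℝ} (hv : 0 ≤ v) (hvw : v ≤ w) : norm1 v ≤ norm1 w := by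
  rw [norm1_eq_sum hv, norm1_eq_sum (hv.trans hvw)]
  exact Finset.sum_le_sum fun i _ => hvw i

lemma continuous_norm1 : Continuous (norm1 : (Fin m → ℝ) → ℝ) := by
  unfold norm1; fun_prop

lemma apply_le_norm1 {v : Fin m → ℝ} (i : Fin m) : v i ≤ norm1 v :=
  (le_abs_self _).trans
    (Finset.single_le_sum (f := fun i => |v i|) (fun _ _ => abs_nonneg _) (Finset.mem_univ i))

lemma mem_stdSimplex_iff {v : Fin m → ℝ} :
    v ∈ stdSimplex ℝ (Fin m) ↔ 0 ≤ v ∧ norm1 v = 1 := by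
  constructor
  · rintro ⟨h0, h1⟩
    exact ⟨h0, by rw [norm1_eq_sum h0, h1]⟩
  · rintro ⟨h0, h1⟩
    exact ⟨h0, by rw [← norm1_eq_sum h0, h1]⟩

/-! ### Words acting on nonnegative vectors -/

lemma vecMul_nonneg_of_nonneg {N : Matrix (Fin m) (Fin m) ℝ} (hN : ∀ i j, 0 ≤ N i j)
    {v : Fin m → ℝ} (hv : 0 ≤ v) : 0 ≤ v ᵥ* N := fun j => by
  simp only [Pi.zero_apply, Matrix.vecMul, dotProduct]
  exact Finset.sum_nonneg fun i _ => mul_nonneg (hv i) (hN i j)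

lemma vecMul_wordMat_nonneg {M : A → Matrix (Fin m) (Fin m) ℝ} (hM : IsNonneg M)
    {v : Fin m → ℝ} (hv : 0 ≤ v) (u : List A) : 0 ≤ v ᵥ* wordMat M u :=
  vecMul_nonneg_of_nonneg (wordMat_nonneg hM u) hv

lemma vecMul_wordMat_mono {M : A → Matrix (Fin m) (Fin m) ℝ} (hM : IsNonneg M)
    {v v' : Fin m → ℝ} (h : v ≤ v') (u : List A) : v ᵥ* wordMat M u ≤ v' ᵥ* wordMat M u := by
  have := vecMul_wordMat_nonneg hM (sub_nonneg.2 h) u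
  rwa [Matrix.sub_vecMul, sub_nonneg] at this

@[simp] lemma wordMat_nil (M : A → Matrix (Fin m) (Fin m) ℝ) : wordMat M [] = 1 := rfl

lemma wordMat_append (M : A → Matrix (Fin m) (Fin m) ℝ) (u t : List A) :
    wordMat M (u ++ t) = wordMat M u * wordMat M t := by
  simp [wordMat]

lemma wordMat_cons (M : A → Matrix (Fin m) (Fin m) ℝ) (a : A) (u : List A) :
    wordMat M (a :: u) = M a * wordMat M u := by
  simp [wordMat]

lemma wordMat_singleton (M : A → Matrix (Fin m) (Fin m) ℝ) (a : A) : wordMat M [a] = M a := by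
  simp [wordMat]

lemma vecMul_wordMat_append (M : A → Matrix (Fin m) (Fin m) ℝ) (v : Fin m → ℝ) (u t : List A) :
    v ᵥ* wordMat M (u ++ t) = (v ᵥ* wordMat M u) ᵥ* wordMat M t := by
  rw [wordMat_append, Matrix.vecMul_vecMul]

lemma vecMul_wordMat_cons (M : A → Matrix (Fin m) (Fin m) ℝ) (v : Fin m → ℝ) (a : A)
    (u : List A) : v ᵥ* wordMat M (a :: u) = (v ᵥ* M a) ᵥ* wordMat M u := by
  rw [wordMat_cons, Matrix.vecMul_vecMul]

lemma continuous_vecMul_right (N : Matrix (Fin m) (Fin m) ℝ) :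
    Continuous fun v : Fin m → ℝ => v ᵥ* N :=
  continuous_id.matrix_vecMul continuous_const

lemma supp_nonempty_iff {v : Fin m → ℝ} (hv : 0 ≤ v) : (supp v).Nonempty ↔ v ≠ 0 := by
  rw [← not_iff_not, Set.not_nonempty_iff_eq_empty, not_not, Set.eq_empty_iff_forall_notMem,
    funext_iff]
  exact forall_congr' fun i => by
    simp only [supp, Set.mem_ofPred_eq, not_lt, Pi.zero_apply]
    exact ⟨fun h => le_antisymm h (hv i), le_of_eq⟩

/-- The action of words on sets is the extended transition function of the support automaton. -/
lemma foldl_supportStep {M : A → Matrix (Fin m) (Fin m) ℝ} (hM : IsNonneg M) (u : List A)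
    (E : Set (Fin m)) : u.foldl (supportStep M) E = setAct M E u := by
  classical
  induction u generalizing E with
  | nil =>
    ext j
    simp only [List.foldl_nil, setAct, wordMat_nil, Set.mem_ofPred_eq, Matrix.one_apply]
    constructor
    · exact fun h => ⟨j, h, by simp⟩
    · rintro ⟨i, hi, h⟩
      split_ifs at h with hij
      · exact hij ▸ hi
      · exact absurd h (lt_irrefl _)
  | cons a u ih =>
    -- compare the supports of `v M_a M_u` for the indicator vector `v` of `E`
    have hE : supp (E.indicator fun _ => (1 : ℝ)) = E := by
      ext i
      by_cases hi : i ∈ E <;> simp [supp, hi]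
    have h0 : 0 ≤ E.indicator fun _ => (1 : ℝ) := fun i => by
      by_cases hi : i ∈ E <;> simp [hi]
    rw [List.foldl_cons, ih, supportStep]
    conv_lhs => rw [← hE]
    conv_rhs => rw [← hE]
    rw [← supp_vecMul_wordMat hM h0, ← supp_vecMul_wordMat hM h0,
      ← supp_vecMul_wordMat hM (vecMul_wordMat_nonneg hM h0 _), ← vecMul_wordMat_append]
    rfl

lemma setAct_mem_of_isBSCC {M : A → Matrix (Fin m) (Fin m) ℝ} (hM : IsNonneg M)
    {Q B : Set (Set (Fin m))} (hB : IsBSCC (supportStep M) Q B) {E : Set (Fin m)} (hE : E ∈ B)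
    (u : List A) : setAct M E u ∈ B := by
  rw [← foldl_supportStep hM]
  induction u generalizing E with
  | nil => exact hE
  | cons a u ih => exact ih (hB.bottom E hE a)

lemma empty_notMem_of_isNonNullBSCC {M : A → Matrix (Fin m) (Fin m) ℝ} (hM : IsNonneg M)
    {B : Set (Set (Fin m))} (hB : IsNonNullBSCC M B) : ∅ ∉ B := by
  intro h
  refine hB.2 (Set.eq_singleton_iff_unique_mem.2 ⟨h, fun E hE => ?_⟩)
  obtain ⟨u, hu⟩ := hB.1.connected _ h _ hE
  rw [← hu, foldl_supportStep hM]
  simp [setAct]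

/-- A nonnegative vector whose support lies in a non-null bottom component is never killed. -/
lemma vecMul_wordMat_ne_zero {M : A → Matrix (Fin m) (Fin m) ℝ} (hM : IsNonneg M)
    {B : Set (Set (Fin m))} (hB : IsNonNullBSCC M B) {v : Fin m → ℝ} (hv : 0 ≤ v)
    (hvB : supp v ∈ B) (u : List A) : v ᵥ* wordMat M u ≠ 0 := by
  rw [← supp_nonempty_iff (vecMul_wordMat_nonneg hM hv u), supp_vecMul_wordMat hM hv,
    Set.nonempty_iff_ne_empty]
  intro h
  exact empty_notMem_of_isNonNullBSCC hM hB (h ▸ setAct_mem_of_isBSCC hM hB.1 hvB u)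

/-! ### Conservative vectors -/

/-- A vector whose norm is preserved by every word. -/
def IsConservative (M : A → Matrix (Fin m) (Fin m) ℝ) (v : Fin m → ℝ) : Prop :=
  ∀ u : List A, norm1 (v ᵥ* wordMat M u) = norm1 v

lemma IsConservative.vecMul {M : A → Matrix (Fin m) (Fin m) ℝ} {v : Fin m → ℝ}
    (h : IsConservative M v) (u : List A) : IsConservative M (v ᵥ* wordMat M u) := fun t => by
  rw [← vecMul_wordMat_append, h, h]

lemma IsConservative.smul {M : A → Matrix (Fin m) (Fin m) ℝ} {v : Fin m → ℝ}
    (h : IsConservative M v) {c : ℝ} (hc : 0 ≤ c) : IsConservative M (c • v) := fun u => by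
  rw [Matrix.smul_vecMul, norm1_smul hc, norm1_smul hc, h]

lemma isClosed_isConservative (M : A → Matrix (Fin m) (Fin m) ℝ) :
    IsClosed {v | IsConservative M v} := by
  simp only [IsConservative, Set.ofPred_forall]
  exact isClosed_iInter fun u =>
    isClosed_eq (continuous_norm1.comp (continuous_vecMul_right _)) continuous_norm1

/-- The risk vanishes along the orbit of a conservative vector. -/
lemma IsConservative.risk_dirAct_eq_zero [Fintype A] [Nonempty A]
    {M : A → Matrix (Fin m) (Fin m) ℝ} {x : Fin m → ℝ} (h : IsConservative M x)
    (hx : norm1 x = 1) (z : List A) : risk M (dirAct M x z) = 0 := by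
  have hz : dirAct M x z = x ᵥ* wordMat M z := by
    rw [dirAct, h z, hx, inv_one, one_smul]
  have h1 : ∀ a, norm1 ((x ᵥ* wordMat M z) ᵥ* M a) = 1 := fun a => by
    have := h (z ++ [a])
    rwa [vecMul_wordMat_append, wordMat_singleton, hx] at this
  rw [hz, risk, if_neg]
  · simp only [h1, h z, hx]
    simp
  · rintro ⟨a, ha⟩
    have := h1 a
    rw [ha] at this
    simp [norm1] at this

lemma IsSuperfair.sum_le [Fintype A] [Nonempty A] {M : A → Matrix (Fin m) (Fin m) ℝ}
    (h : IsSuperfair M) {v : Fin m → ℝ} (hv : 0 ≤ v) :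
    ∑ a, norm1 (v ᵥ* M a) ≤ Fintype.card A * norm1 v := by
  have := h v hv
  rwa [div_le_iff₀ (by exact_mod_cast Fintype.card_pos), mul_comm] at this

/-- If a conservative vector dominates a positive multiple of `x`, then the superfair inequality
is an equality all along the orbit of `x`: a loss of `x` on average could not be made up for by
the remainder. -/
lemma sum_norm1_eq_of_le_isConservative [Fintype A] [Nonempty A]
    {M : A → Matrix (Fin m) (Fin m) ℝ}
    (hM : IsNonneg M) (hfair : IsSuperfair M) {v x : Fin m → ℝ} (hv : IsConservative M v)
    (hx : 0 ≤ x) {c : ℝ} (hc : 0 < c) (hxv : c • x ≤ v) (u : List A) :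
    ∑ a, norm1 ((x ᵥ* wordMat M u) ᵥ* M a) = Fintype.card A * norm1 (x ᵥ* wordMat M u) := by
  set y := x ᵥ* wordMat M u with hy
  set r := (v - c • x) ᵥ* wordMat M u with hr
  have hy0 : 0 ≤ y := vecMul_wordMat_nonneg hM hx u
  have hr0 : 0 ≤ r := vecMul_wordMat_nonneg hM (sub_nonneg.2 hxv) u
  have hcy : 0 ≤ c • y := smul_nonneg hc.le hy0
  have hsum : v ᵥ* wordMat M u = c • y + r := by
    rw [hy, hr, ← Matrix.smul_vecMul, ← Matrix.add_vecMul, add_sub_cancel]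
  have h1 : norm1 v = c * norm1 y + norm1 r := by
    rw [← hv u, hsum, norm1_add hcy hr0, norm1_smul hc.le]
  have h2 : ∀ a, norm1 v = c * norm1 (y ᵥ* M a) + norm1 (r ᵥ* M a) := fun a => by
    rw [← hv (u ++ [a]), vecMul_wordMat_append, wordMat_singleton, hsum, Matrix.add_vecMul,
      Matrix.smul_vecMul, norm1_add (smul_nonneg hc.le (vecMul_nonneg_of_nonneg (hM a) hy0))
        (vecMul_nonneg_of_nonneg (hM a) hr0), norm1_smul hc.le]
  have h3 : (Fintype.card A : ℝ) * norm1 v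
      = c * ∑ a, norm1 (y ᵥ* M a) + ∑ a, norm1 (r ᵥ* M a) := by
    rw [Finset.mul_sum, ← Finset.sum_add_distrib, ← Finset.sum_congr rfl fun a _ => h2 a]
    simp
  have h4 := hfair.sum_le hy0
  have h5 := hfair.sum_le hr0
  refine le_antisymm h4 (le_of_mul_le_mul_left ?_ hc)
  rw [h1] at h3
  linarith

/-- If the orbit of `x` is bounded and fair at every step, a vector of maximal norm in its
closure is conservative. -/
lemma exists_isConservative_mem_closure [Fintype A] [Nonempty A]
    {M : A → Matrix (Fin m) (Fin m) ℝ} (hM : IsNonneg M) {x : Fin m → ℝ} (hx : 0 ≤ x) {C : ℝ}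
    (hC : ∀ u, norm1 (x ᵥ* wordMat M u) ≤ C)
    (heq : ∀ u, ∑ a, norm1 ((x ᵥ* wordMat M u) ᵥ* M a)
      = Fintype.card A * norm1 (x ᵥ* wordMat M u)) :
    ∃ y ∈ closure (Set.range fun u => x ᵥ* wordMat M u),
      norm1 x ≤ norm1 y ∧ IsConservative M y := by
  set D := closure (Set.range fun u => x ᵥ* wordMat M u) with hD
  have hxD : x ∈ D := subset_closure ⟨[], by simp⟩
  have hDc : IsCompact D := by
    refine (isCompact_Icc (a := (0 : Fin m → ℝ)) (b := fun _ => C)).of_isClosed_subset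
      isClosed_closure (closure_minimal ?_ isClosed_Icc)
    rintro _ ⟨u, rfl⟩
    exact ⟨vecMul_wordMat_nonneg hM hx u, fun i => (apply_le_norm1 i).trans (hC u)⟩
  have hDM : ∀ y ∈ D, ∀ a, y ᵥ* M a ∈ D := fun y hy a =>
    map_mem_closure (f := fun v => v ᵥ* M a) (continuous_vecMul_right (M a)) hy (by
      rintro _ ⟨u, rfl⟩
      exact ⟨u ++ [a], by simp only [vecMul_wordMat_append, wordMat_singleton]⟩)
  have hDeq : ∀ y ∈ D, ∑ a, norm1 (y ᵥ* M a) = Fintype.card A * norm1 y := by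
    have hcl : IsClosed {y : Fin m → ℝ | ∑ a, norm1 (y ᵥ* M a) = Fintype.card A * norm1 y} :=
      isClosed_eq (continuous_finsetSum _ fun a _ =>
        continuous_norm1.comp (continuous_vecMul_right _)) (continuous_const.mul continuous_norm1)
    exact fun y hy => closure_minimal (by rintro _ ⟨u, rfl⟩; exact heq u) hcl hy
  obtain ⟨y, hyD, hmax⟩ := hDc.exists_isMaxOn ⟨x, hxD⟩ continuous_norm1.continuousOn
  refine ⟨y, hyD, hmax hxD, ?_⟩
  have key : ∀ u : List A, ∀ y' ∈ D, norm1 y' = norm1 y →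
      norm1 (y' ᵥ* wordMat M u) = norm1 y := by
    intro u
    induction u with
    | nil => intro y' _ h; simpa using h
    | cons a u ih =>
      intro y' hy' h
      rw [vecMul_wordMat_cons]
      refine ih _ (hDM _ hy' a) ?_
      -- the average of numbers that are at most `‖y‖` equals `‖y‖`
      have hle : ∀ a ∈ Finset.univ, norm1 (y' ᵥ* M a) ≤ norm1 y :=
        fun a _ => hmax (hDM _ hy' a)
      exact (Finset.sum_eq_sum_iff_of_le hle).1 (by simp [hDeq _ hy', h]) a (Finset.mem_univ a)
  exact fun u => key u y hyD rfl

/-! ### Conservative vectors and the fixed direction -/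

lemma exists_pos_smul_le {x v : Fin m → ℝ} (hx : 0 ≤ x) (hv : 0 ≤ v) (h : supp x ⊆ supp v) :
    ∃ c : ℝ, 0 < c ∧ c • x ≤ v := by
  have key : ∀ i, ∀ᶠ c : ℝ in 𝓝[>] 0, c * x i ≤ v i := fun i => by
    by_cases hi : 0 < x i
    · have ht : Tendsto (fun c : ℝ => c * x i) (𝓝[>] 0) (𝓝 0) := by
        have : Tendsto (fun c : ℝ => c * x i) (𝓝 0) (𝓝 (0 * x i)) :=
          tendsto_id.mul_const _
        rw [zero_mul] at this
        exact this.mono_left nhdsWithin_le_nhds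
      exact (ht.eventually_lt_const (h hi : 0 < v i)).mono fun c hc => hc.le
    · have hxi : x i = 0 := le_antisymm (not_lt.1 hi) (hx i)
      exact Eventually.of_forall fun c => by rw [hxi, mul_zero]; exact hv i
  obtain ⟨c, hc, hc0⟩ := ((eventually_all.2 key).and self_mem_nhdsWithin).exists
  exact ⟨c, hc0, hc⟩

lemma setAct_append {M : A → Matrix (Fin m) (Fin m) ℝ} (hM : IsNonneg M) (E : Set (Fin m))
    (u t : List A) : setAct M E (u ++ t) = setAct M (setAct M E u) t := by
  simp only [← foldl_supportStep hM, List.foldl_append]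

lemma setAct_mono (M : A → Matrix (Fin m) (Fin m) ℝ) {E E' : Set (Fin m)} (h : E ⊆ E')
    (u : List A) : setAct M E u ⊆ setAct M E' u := by
  rintro j ⟨i, hi, hij⟩
  exact ⟨i, h hi, hij⟩

/-- By (★), every nonzero vector has an image whose support contains a given reachable state. -/
lemma exists_subset_supp_vecMul {M : A → Matrix (Fin m) (Fin m) ℝ} (hM : IsNonneg M)
    (hstar : IsStar M) {F : Set (Fin m)} (hF : F ∈ reachableStates M) {v : Fin m → ℝ}
    (hv : 0 ≤ v) (hv0 : v ≠ 0) : ∃ u : List A, F ⊆ supp (v ᵥ* wordMat M u) := by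
  obtain ⟨j, t, hjt⟩ := hF
  obtain ⟨i, hi⟩ := (supp_nonempty_iff hv).2 hv0
  obtain ⟨p, hp⟩ := hstar i j
  refine ⟨p ++ t, ?_⟩
  rw [supp_vecMul_wordMat hM hv, setAct_append hM, ← hjt, foldl_supportStep hM]
  have hj : j ∈ setAct M (supp v) p := ⟨i, hi, hp⟩
  exact setAct_mono M (Set.singleton_subset_iff.2 hj) t

/-- A vector in the closure of the orbit of a vector with support `F` in a bottom component has
an image supported in `F`. -/
lemma exists_vecMul_eq_zero_off_of_mem_closure {M : A → Matrix (Fin m) (Fin m) ℝ}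
    (hM : IsNonneg M) {Q B : Set (Set (Fin m))} (hB : IsBSCC (supportStep M) Q B)
    {F : Set (Fin m)} (hF : F ∈ B) {x : Fin m → ℝ} (hx : 0 ≤ x) (hxF : supp x = F)
    {y : Fin m → ℝ} (hy : y ∈ closure (Set.range fun u => x ᵥ* wordMat M u)) :
    ∃ t : List A, ∀ i ∉ F, (y ᵥ* wordMat M t) i = 0 := by
  -- there are finitely many supports, so `y` is a limit of vectors sharing one support `E`
  have hU : (Set.range fun u => x ᵥ* wordMat M u)
      = ⋃ E : Set (Fin m), (fun u => x ᵥ* wordMat M u) '' {u | setAct M F u = E} := by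
    ext z
    simp
  rw [hU, closure_iUnion_of_finite, Set.mem_iUnion] at hy
  obtain ⟨E, hy⟩ := hy
  have hE : E ∈ B := by
    obtain ⟨_, u, hu, -⟩ := closure_nonempty_iff.1 ⟨y, hy⟩
    rw [← (show setAct M F u = E from hu)]
    exact setAct_mem_of_isBSCC hM hB hF u
  obtain ⟨t, ht⟩ := hB.connected E hE F hF
  rw [foldl_supportStep hM] at ht
  refine ⟨t, fun i hi => ?_⟩
  have hcl : IsClosed {z : Fin m → ℝ | (z ᵥ* wordMat M t) i = 0} :=
    isClosed_eq ((continuous_apply i).comp (continuous_vecMul_right _)) continuous_const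
  refine closure_minimal (t := {z : Fin m → ℝ | (z ᵥ* wordMat M t) i = 0}) ?_ hcl hy
  rintro _ ⟨u, hu, rfl⟩
  have hu : setAct M F u = E := hu
  have hni : i ∉ supp ((x ᵥ* wordMat M u) ᵥ* wordMat M t) := by
    rwa [← vecMul_wordMat_append, supp_vecMul_wordMat hM hx, setAct_append hM, hxF, hu, ht]
  exact le_antisymm (not_lt.1 hni)
    (vecMul_wordMat_nonneg hM (vecMul_wordMat_nonneg hM hx u) t i)

lemma IsFixedDirection.vecMul_wordMat {M : A → Matrix (Fin m) (Fin m) ℝ} {F : Set (Fin m)}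
    {w : List A} {x : Fin m → ℝ} (hx : IsFixedDirection M F w x) :
    0 < norm1 (x ᵥ* wordMat M w) ∧ x ᵥ* wordMat M w = norm1 (x ᵥ* wordMat M w) • x := by
  obtain ⟨⟨hx0, hx1, hxF⟩, hfix⟩ := hx
  have hne : x ᵥ* wordMat M w ≠ 0 := fun h => by
    rw [dirAct, h, smul_zero] at hfix
    rw [← hfix] at hx1
    simp [norm1] at hx1
  have hpos := norm1_pos hne
  refine ⟨hpos, ?_⟩
  rw [dirAct] at hfix
  have := smul_inv_smul₀ hpos.ne' (x ᵥ* wordMat M w)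
  rw [hfix] at this
  exact this.symm

/-- The eigenvalue of a fixed direction with bounded orbit is at most `1`. -/
lemma IsFixedDirection.norm1_vecMul_le_one {M : A → Matrix (Fin m) (Fin m) ℝ} {F : Set (Fin m)}
    {w : List A} {x : Fin m → ℝ} (hx : IsFixedDirection M F w x) {C : ℝ}
    (hC : ∀ u, norm1 (x ᵥ* wordMat M u) ≤ C) : norm1 (x ᵥ* wordMat M w) ≤ 1 := by
  obtain ⟨hpos, heig⟩ := hx.vecMul_wordMat
  set l := norm1 (x ᵥ* wordMat M w)
  by_contra! hl
  have hpow : ∀ k : ℕ, ∃ u, x ᵥ* wordMat M u = l ^ k • x := fun k => by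
    induction k with
    | zero => exact ⟨[], by simp⟩
    | succ k ih =>
      obtain ⟨u, hu⟩ := ih
      exact ⟨u ++ w, by rw [vecMul_wordMat_append, hu, Matrix.smul_vecMul, heig, smul_smul,
        pow_succ]⟩
  obtain ⟨k, hk⟩ := pow_unbounded_of_one_lt C hl
  obtain ⟨u, hu⟩ := hpow k
  have := hC u
  rw [hu, norm1_smul (pow_nonneg hpos.le k), hx.1.2.1, mul_one] at this
  linarith

/-- If some conservative unit vector is supported in `F` and the eigenvalue of the fixed
direction `x` of a word pseudo-mixing `F` is at most `1`, then `x` is conservative.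

Among the conservative unit vectors `y` supported in `F`, take one with `y ≤ C x` for the least
possible `C`. The word `w` sends the remainder `C x - y` to `0` or to a vector positive on all
of `F`; the latter would allow a smaller `C` for `y M_w`, and the former makes `y M_w` a multiple
of `x`. -/
lemma IsFixedDirection.isConservative {M : A → Matrix (Fin m) (Fin m) ℝ} (hM : IsNonneg M)
    {F : Set (Fin m)} {w : List A} (hw : PseudoMixes M w F) {x : Fin m → ℝ}
    (hx : IsFixedDirection M F w x) (hl : norm1 (x ᵥ* wordMat M w) ≤ 1) {y : Fin m → ℝ}
    (hy : y ∈ stdSimplex ℝ (Fin m)) (hyF : ∀ i ∉ F, y i = 0) (hyc : IsConservative M y) :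
    IsConservative M x := by
  obtain ⟨hpos, heig⟩ := hx.vecMul_wordMat
  obtain ⟨⟨hx0, hx1, hxF⟩, -⟩ := hx
  set l := norm1 (x ᵥ* wordMat M w)
  have hy' := mem_stdSimplex_iff.1 hy
  have hxoff : ∀ i ∉ F, x i = 0 := fun i hi =>
    le_antisymm (not_lt.1 (show i ∉ supp x from hxF ▸ hi)) (hx0 i)
  obtain ⟨c, hc, hcy⟩ := exists_pos_smul_le hy'.1 hx0 (by
    intro i hi
    by_contra hi'
    rw [hxF] at hi'
    exact (ne_of_gt (show 0 < y i from hi)) (hyF i hi') : supp y ⊆ supp x)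
  have hyx : y ≤ c⁻¹ • x := by
    have := smul_le_smul_of_nonneg_left hcy (inv_nonneg.2 hc.le)
    rwa [inv_smul_smul₀ hc.ne'] at this
  let S : Set ((Fin m → ℝ) × ℝ) :=
    (stdSimplex ℝ (Fin m) ×ˢ Set.Icc 0 c⁻¹) ∩
      {p | (∀ i ∉ F, p.1 i = 0) ∧ IsConservative M p.1 ∧ p.1 ≤ p.2 • x}
  have hS : IsCompact S := by
    refine ((isCompact_stdSimplex ℝ (Fin m)).prod isCompact_Icc).inter_right ?_
    refine IsClosed.inter ?_ (IsClosed.inter ?_ ?_)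
    · change IsClosed {p : (Fin m → ℝ) × ℝ | ∀ i ∉ F, p.1 i = 0}
      simp only [Set.ofPred_forall]
      exact isClosed_iInter fun i => isClosed_iInter fun _ =>
        isClosed_eq (by fun_prop) continuous_const
    · exact (isClosed_isConservative M).preimage continuous_fst
    · exact isClosed_le continuous_fst (by fun_prop)
  obtain ⟨⟨z, C⟩, ⟨⟨hz, hC⟩, hzF, hzc, hzC⟩, hmin⟩ :=
    hS.exists_isMinOn ⟨(y, c⁻¹), ⟨hy, inv_nonneg.2 hc.le, le_rfl⟩, hyF, hyc, hyx⟩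
      continuous_snd.continuousOn
  change z ∈ _ at hz
  change C ∈ _ at hC
  change z ≤ C • x at hzC
  change IsConservative M z at hzc
  change ∀ i ∉ F, z i = 0 at hzF
  have hz' := mem_stdSimplex_iff.1 hz
  have hr0 : 0 ≤ C • x - z := sub_nonneg.2 hzC
  have hrF : supp (C • x - z) ⊆ F := by
    intro i hi
    by_contra hi'
    simp [supp, hxoff i hi', hzF i hi'] at hi
  have hrw : (C • x - z) ᵥ* wordMat M w = (C * l) • x - z ᵥ* wordMat M w := by
    rw [Matrix.sub_vecMul, Matrix.smul_vecMul, heig, smul_smul]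
  have hz1 : norm1 (z ᵥ* wordMat M w) = 1 := (hzc w).trans hz'.2
  have hzw0 := vecMul_wordMat_nonneg hM hz'.1 w
  by_cases hcase : ∃ i ∈ supp (C • x - z), setAct M {i} w = F
  · exfalso
    obtain ⟨i, hi, hiF⟩ := hcase
    have hsub : supp x ⊆ supp ((C • x - z) ᵥ* wordMat M w) := by
      rw [supp_vecMul_wordMat hM hr0, hxF, ← hiF]
      exact setAct_mono M (Set.singleton_subset_iff.2 hi) w
    obtain ⟨ε, hε, hεx⟩ := exists_pos_smul_le hx0 (vecMul_wordMat_nonneg hM hr0 w) hsub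
    have hle : z ᵥ* wordMat M w ≤ (C - ε) • x := by
      intro j
      have h1 := hεx j
      rw [hrw] at h1
      simp only [Pi.smul_apply, Pi.sub_apply, smul_eq_mul] at h1 ⊢
      have h2 : C * l * x j ≤ C * x j :=
        mul_le_mul_of_nonneg_right (mul_le_of_le_one_right hC.1 hl) (hx0 j)
      linarith
    have hCε : 0 ≤ C - ε := by
      by_contra! hneg
      have h1 : z ᵥ* wordMat M w ≤ 0 := hle.trans (smul_nonpos_of_nonpos_of_nonneg hneg.le hx0)
      rw [le_antisymm h1 hzw0] at hz1
      simp [norm1] at hz1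
    have hmem : (z ᵥ* wordMat M w, C - ε) ∈ S := by
      refine ⟨⟨mem_stdSimplex_iff.2 ⟨hzw0, hz1⟩, hCε, by linarith [hC.2]⟩, fun j hj => ?_,
        hzc.vecMul w, hle⟩
      refine le_antisymm ((hle j).trans_eq ?_) (hzw0 j)
      simp [hxoff j hj]
    have := hmin hmem
    simp only [Set.mem_ofPred_eq] at this
    linarith
  · push Not at hcase
    have h0 : (C • x - z) ᵥ* wordMat M w = 0 := by
      by_contra hne
      rw [← ne_eq, ← supp_nonempty_iff (vecMul_wordMat_nonneg hM hr0 w),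
        supp_vecMul_wordMat hM hr0] at hne
      obtain ⟨j, i, hi, hij⟩ := hne
      have hempty := (hw.2 i (hrF hi)).resolve_left (hcase i hi)
      exact (Set.eq_empty_iff_forall_notMem.1 hempty) j ⟨i, rfl, hij⟩
    rw [hrw, sub_eq_zero] at h0
    have hCl : C * l = 1 := by
      rw [← h0, norm1_smul (mul_nonneg hC.1 hpos.le), hx1, mul_one] at hz1
      exact hz1
    rw [hCl, one_smul] at h0
    rw [h0]
    exact hzc.vecMul w

/-- Positive risk somewhere on the orbit of the fixed direction rules out conservative vectors. -/
theorem not_isConservative_of_risk_pos [Fintype A] [Nonempty A]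
    {M : A → Matrix (Fin m) (Fin m) ℝ} (hM : IsNonneg M) (hfair : IsSuperfair M)
    (hstar : IsStar M) {B : Set (Set (Fin m))} (hB : IsNonNullBSCC M B) {F : Set (Fin m)}
    (hF : F ∈ B) {w : List A} (hw : PseudoMixes M w F) {x : Fin m → ℝ}
    (hx : IsFixedDirection M F w x) {z : List A} (hz : 0 < risk M (dirAct M x z))
    {v : Fin m → ℝ} (hv : 0 ≤ v) (hv0 : v ≠ 0) : ¬ IsConservative M v := by
  intro hcons
  have hx' := hx
  obtain ⟨⟨hx0, hx1, hxF⟩, -⟩ := hx'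
  obtain ⟨p, hp⟩ := exists_subset_supp_vecMul hM hstar (hB.1.subset hF) hv hv0
  have hvp := hcons.vecMul p
  obtain ⟨c, hc, hcx⟩ := exists_pos_smul_le hx0 (vecMul_wordMat_nonneg hM hv p)
    (hxF.subset.trans hp)
  have hbound : ∀ u, norm1 (x ᵥ* wordMat M u) ≤ norm1 (v ᵥ* wordMat M p) / c := fun u => by
    rw [le_div_iff₀ hc, mul_comm, ← norm1_smul hc.le, ← hvp u, ← Matrix.smul_vecMul]
    exact norm1_mono (vecMul_wordMat_nonneg hM (smul_nonneg hc.le hx0) u)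
      (vecMul_wordMat_mono hM hcx u)
  obtain ⟨y, hyD, hxy, hyc⟩ := exists_isConservative_mem_closure hM hx0 hbound
    (sum_norm1_eq_of_le_isConservative hM hfair hvp hx0 hc hcx)
  have hy0 : 0 ≤ y := closure_minimal (t := Set.Ici 0)
    (by rintro _ ⟨u, rfl⟩; exact vecMul_wordMat_nonneg hM hx0 u) isClosed_Ici hyD
  obtain ⟨t, ht⟩ := exists_vecMul_eq_zero_off_of_mem_closure hM hB.1 hF hx0 hxF hyD
  have hypos : 0 < norm1 y := lt_of_lt_of_le (hx1 ▸ one_pos) hxy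
  have hxc : IsConservative M x := by
    refine hx.isConservative hM hw (hx.norm1_vecMul_le_one hbound)
      (y := (norm1 y)⁻¹ • (y ᵥ* wordMat M t)) (mem_stdSimplex_iff.2 ⟨?_, ?_⟩) (fun i hi => ?_)
      ((hyc.vecMul t).smul (inv_nonneg.2 hypos.le))
    · exact smul_nonneg (inv_nonneg.2 hypos.le) (vecMul_wordMat_nonneg hM hy0 t)
    · rw [norm1_smul (inv_nonneg.2 hypos.le), hyc t, inv_mul_cancel₀ hypos.ne']
    · simp [ht i hi]
  exact hz.ne' (hxc.risk_dirAct_eq_zero hx1 z)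

/-! ### Contraction of the square-root moment -/

/-- Jensen's inequality for the square root over a finite type, with its equality case. -/
lemma sum_sqrt_le_of_sum_le [Fintype A] {z : A → ℝ} {s : ℝ} (hz : ∀ a, 0 ≤ z a) (hs : 0 ≤ s)
    (hsum : ∑ a, z a ≤ Fintype.card A * s) :
    ∑ a, √(z a) ≤ Fintype.card A * √s ∧
      (Fintype.card A * √s ≤ ∑ a, √(z a) → ∀ a, z a = s) := by
  have hsq : ∑ a, (√(z a) - √s) ^ 2
      = ∑ a, z a - 2 * √s * ∑ a, √(z a) + Fintype.card A * s := by
    have : ∀ a, (√(z a) - √s) ^ 2 = z a - 2 * √s * √(z a) + s := fun a => by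
      rw [sub_sq, Real.sq_sqrt (hz a), Real.sq_sqrt hs]; ring
    simp only [this, Finset.sum_add_distrib, Finset.sum_sub_distrib, ← Finset.mul_sum]
    simp
  have hss := Real.mul_self_sqrt hs
  constructor
  · refine abs_le_of_sq_le_sq' ?_ (by positivity) |>.2
    refine (sq_sum_le_card_mul_sum_sq).trans ?_
    simp only [Real.sq_sqrt (hz _), Finset.card_univ]
    calc (Fintype.card A : ℝ) * ∑ a, z a ≤ Fintype.card A * (Fintype.card A * s) := by gcongr
      _ = (Fintype.card A * √s) ^ 2 := by rw [mul_pow, Real.sq_sqrt hs]; ring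
  · intro hge a
    have h1 := mul_le_mul_of_nonneg_left hge (Real.sqrt_nonneg s)
    have h0 : ∑ a, (√(z a) - √s) ^ 2 = 0 := by
      refine le_antisymm ?_ (Finset.sum_nonneg fun _ _ => sq_nonneg _)
      rw [hsq]
      nlinarith
    have h2 := (Finset.sum_eq_zero_iff_of_nonneg fun _ _ => sq_nonneg _).1 h0 a
      (Finset.mem_univ a)
    exact (Real.sqrt_inj (hz a) hs).1 (sub_eq_zero.1 (pow_eq_zero_iff two_ne_zero |>.1 h2))

/-- The mean of `√‖v M_u‖` over the words `u` of length `n`, defined by recursion on the first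
letter of `u`. -/
noncomputable def sqrtMean [Fintype A] (M : A → Matrix (Fin m) (Fin m) ℝ) :
    ℕ → (Fin m → ℝ) → ℝ
  | 0, v => √(norm1 v)
  | n + 1, v => (∑ a, sqrtMean M n (v ᵥ* M a)) / Fintype.card A

section

variable [Fintype A] {M : A → Matrix (Fin m) (Fin m) ℝ}

lemma sqrtMean_le_sqrt [Nonempty A] (hM : IsNonneg M) (hfair : IsSuperfair M) (n : ℕ)
    {v : Fin m → ℝ} (hv : 0 ≤ v) : sqrtMean M n v ≤ √(norm1 v) := by
  have hA : (0 : ℝ) < Fintype.card A := by exact_mod_cast Fintype.card_pos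
  induction n generalizing v with
  | zero => exact le_rfl
  | succ n ih =>
    rw [sqrtMean, div_le_iff₀ hA, mul_comm]
    exact (Finset.sum_le_sum fun a _ => ih (vecMul_nonneg_of_nonneg (hM a) hv)).trans
      (sum_sqrt_le_of_sum_le (fun _ => norm1_nonneg _) (norm1_nonneg v) (hfair.sum_le hv)).1

lemma sqrtMean_succ_le [Nonempty A] (hM : IsNonneg M) (hfair : IsSuperfair M) (n : ℕ)
    {v : Fin m → ℝ} (hv : 0 ≤ v) : sqrtMean M (n + 1) v ≤ sqrtMean M n v := by
  induction n generalizing v with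
  | zero => exact sqrtMean_le_sqrt hM hfair 1 hv
  | succ n ih =>
    rw [sqrtMean, sqrtMean]
    gcongr with a
    exact ih (vecMul_nonneg_of_nonneg (hM a) hv)

lemma continuous_sqrtMean (n : ℕ) : Continuous (sqrtMean M n) := by
  induction n with
  | zero => exact continuous_norm1.sqrt
  | succ n ih =>
    simp only [sqrtMean]
    exact (continuous_finsetSum _ fun a _ => ih.comp (continuous_vecMul_right _)).div_const _

lemma sqrtMean_smul (n : ℕ) {c : ℝ} (hc : 0 ≤ c) (v : Fin m → ℝ) :
    sqrtMean M n (c • v) = √c * sqrtMean M n v := by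
  induction n generalizing v with
  | zero => rw [sqrtMean, sqrtMean, norm1_smul hc, Real.sqrt_mul hc]
  | succ n ih =>
    simp only [sqrtMean, Matrix.smul_vecMul, ih, ← Finset.mul_sum, mul_div_assoc]

/-- A vector whose square-root moments never decrease is conservative. -/
lemma isConservative_of_sqrt_le_sqrtMean [Nonempty A] (hM : IsNonneg M) (hfair : IsSuperfair M)
    {v : Fin m → ℝ} (hv : 0 ≤ v) (h : ∀ n, √(norm1 v) ≤ sqrtMean M n v) :
    IsConservative M v := by
  have hA : (0 : ℝ) < Fintype.card A := by exact_mod_cast Fintype.card_pos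
  intro u
  induction u generalizing v with
  | nil => simp
  | cons a u ih =>
    have hva := fun a => vecMul_nonneg_of_nonneg (hM a) hv
    have hJ := sum_sqrt_le_of_sum_le (fun a => norm1_nonneg (v ᵥ* M a)) (norm1_nonneg v)
      (hfair.sum_le hv)
    have hmul : ∀ n, Fintype.card A * √(norm1 v) ≤ ∑ a, sqrtMean M n (v ᵥ* M a) := fun n => by
      have := h (n + 1)
      rwa [sqrtMean, le_div_iff₀ hA, mul_comm] at this
    have hnorm := hJ.2 (hmul 0)
    rw [vecMul_wordMat_cons, ih (hva a), hnorm]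
    intro n
    have hle : ∀ b ∈ Finset.univ, sqrtMean M n (v ᵥ* M b) ≤ √(norm1 (v ᵥ* M b)) :=
      fun b _ => sqrtMean_le_sqrt hM hfair n (hva b)
    have heq : ∑ b, sqrtMean M n (v ᵥ* M b) = ∑ b, √(norm1 (v ᵥ* M b)) :=
      le_antisymm (Finset.sum_le_sum hle) (hJ.1.trans (hmul n))
    exact ((Finset.sum_eq_sum_iff_of_le hle).1 heq a (Finset.mem_univ a)).ge

/-- Without conservative vectors, compactness of the simplex makes the square-root moment at some
fixed length a strict contraction. -/
lemma exists_sqrtMean_le_mul_sqrt [Nonempty A] [NeZero m] (hM : IsNonneg M) (hfair : IsSuperfair M)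
    (hcons : ∀ v : Fin m → ℝ, 0 ≤ v → v ≠ 0 → ¬ IsConservative M v) :
    ∃ n : ℕ, ∃ c : ℝ, 0 ≤ c ∧ c < 1 ∧
      ∀ v : Fin m → ℝ, 0 ≤ v → sqrtMean M n v ≤ c * √(norm1 v) := by
  have hlt : ∃ n, ∀ v ∈ stdSimplex ℝ (Fin m), sqrtMean M n v < 1 := by
    by_contra! hcon
    have hcl : ∀ n, IsClosed {v : Fin m → ℝ | 1 ≤ sqrtMean M n v} := fun n =>
      isClosed_le continuous_const (continuous_sqrtMean n)
    obtain ⟨v, hv⟩ := IsCompact.nonempty_iInter_of_sequence_nonempty_isCompact_isClosed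
      (fun n => stdSimplex ℝ (Fin m) ∩ {v | 1 ≤ sqrtMean M n v})
      (fun n v hv => ⟨hv.1, hv.2.trans
        (sqrtMean_succ_le hM hfair n (mem_stdSimplex_iff.1 hv.1).1)⟩)
      (fun n => hcon n) ((isCompact_stdSimplex ℝ (Fin m)).inter_right (hcl 0))
      (fun n => (isClosed_stdSimplex ℝ (Fin m)).inter (hcl n))
    rw [Set.mem_iInter] at hv
    obtain ⟨hv0, hv1⟩ := mem_stdSimplex_iff.1 (hv 0).1
    refine hcons v hv0 (fun h => ?_)
      (isConservative_of_sqrt_le_sqrtMean hM hfair hv0 fun n => ?_)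
    · simp [h, norm1] at hv1
    · rw [hv1, Real.sqrt_one]
      exact (hv n).2
  obtain ⟨n, hn⟩ := hlt
  obtain ⟨v₀, hv₀, hmax⟩ := (isCompact_stdSimplex ℝ (Fin m)).exists_isMaxOn
    ⟨_, single_mem_stdSimplex ℝ (0 : Fin m)⟩ (continuous_sqrtMean (M := M) n).continuousOn
  refine ⟨n, max 0 (sqrtMean M n v₀), le_max_left _ _, max_lt one_pos (hn v₀ hv₀),
    fun v hv => ?_⟩
  by_cases hv0 : v = 0
  · have := sqrtMean_le_sqrt hM hfair n hv
    subst hv0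
    simpa [norm1] using this
  have hpos := norm1_pos hv0
  have hmem : (norm1 v)⁻¹ • v ∈ stdSimplex ℝ (Fin m) := mem_stdSimplex_iff.2
    ⟨smul_nonneg (inv_nonneg.2 hpos.le) hv, by
      rw [norm1_smul (inv_nonneg.2 hpos.le), inv_mul_cancel₀ hpos.ne']⟩
  have hle : sqrtMean M n ((norm1 v)⁻¹ • v) ≤ max 0 (sqrtMean M n v₀) :=
    (hmax hmem).trans (le_max_right _ _)
  calc sqrtMean M n v = √(norm1 v) * sqrtMean M n ((norm1 v)⁻¹ • v) := by
        rw [← sqrtMean_smul n hpos.le, smul_inv_smul₀ hpos.ne']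
    _ ≤ √(norm1 v) * max 0 (sqrtMean M n v₀) := by gcongr
    _ = _ := mul_comm _ _

lemma sqrtMean_mul_le_pow (hM : IsNonneg M) {n : ℕ} {c : ℝ} (hc : 0 ≤ c)
    (h : ∀ v : Fin m → ℝ, 0 ≤ v → sqrtMean M n v ≤ c * √(norm1 v)) (k : ℕ) {v : Fin m → ℝ}
    (hv : 0 ≤ v) : sqrtMean M (k * n) v ≤ c ^ k * √(norm1 v) := by
  have hadd : ∀ j : ℕ, ∀ v : Fin m → ℝ, 0 ≤ v →
      sqrtMean M (j + n) v ≤ c * sqrtMean M j v := by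
    intro j
    induction j with
    | zero => intro v hv; rw [zero_add]; exact h v hv
    | succ j ih =>
      intro v hv
      rw [add_right_comm, sqrtMean, sqrtMean, ← mul_div_assoc, Finset.mul_sum]
      gcongr with a
      exact ih _ (vecMul_nonneg_of_nonneg (hM a) hv)
  induction k with
  | zero => simp [sqrtMean]
  | succ k ih =>
    rw [add_mul, one_mul, pow_succ', mul_assoc]
    exact (hadd _ v hv).trans (mul_le_mul_of_nonneg_left ih hc)

lemma sqrtMean_eq_sum (n : ℕ) (v : Fin m → ℝ) :
    sqrtMean M n v = (∑ f : Fin n → A, √(norm1 (v ᵥ* wordMat M (List.ofFn f))))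
      / (Fintype.card A : ℝ) ^ n := by
  induction n generalizing v with
  | zero => simp [sqrtMean]
  | succ n ih =>
    have hcons : ∑ f : Fin (n + 1) → A, √(norm1 (v ᵥ* wordMat M (List.ofFn f)))
        = ∑ a, ∑ f : Fin n → A, √(norm1 ((v ᵥ* M a) ᵥ* wordMat M (List.ofFn f))) := by
      rw [← Fintype.sum_prod_type', ← (Fin.consEquiv fun _ : Fin (n + 1) => A).sum_comp]
      refine Finset.sum_congr rfl fun p _ => ?_
      simp [Fin.consEquiv, List.ofFn_succ, wordMat_cons]
    simp only [hcons, sqrtMean, ih, pow_succ, ← Finset.sum_div, div_div]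

end

/-- The sum of the norms of the rows of a matrix. -/
def rowNormSum (N : Matrix (Fin m) (Fin m) ℝ) : ℝ := ∑ i, norm1 (N i)

lemma norm1_vecMul_le (v : Fin m → ℝ) (N : Matrix (Fin m) (Fin m) ℝ) :
    norm1 (v ᵥ* N) ≤ norm1 v * rowNormSum N := by
  calc norm1 (v ᵥ* N) ≤ ∑ j, ∑ i, |v i| * |N i j| := by
        refine Finset.sum_le_sum fun j _ => ?_
        simp only [Matrix.vecMul, dotProduct]
        exact (Finset.abs_sum_le_sum_abs _ _).trans_eq (by simp only [abs_mul])
    _ = ∑ i, |v i| * norm1 (N i) := by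
        rw [Finset.sum_comm]
        simp only [norm1, Finset.mul_sum]
    _ ≤ ∑ i, |v i| * rowNormSum N := by
        refine Finset.sum_le_sum fun i _ => mul_le_mul_of_nonneg_left ?_ (abs_nonneg _)
        exact Finset.single_le_sum (f := fun i => norm1 (N i)) (fun _ _ => norm1_nonneg _)
          (Finset.mem_univ i)
    _ = norm1 v * rowNormSum N := by rw [norm1, Finset.sum_mul]

lemma sqrt_rowNormSum_le (N : Matrix (Fin m) (Fin m) ℝ) :
    √(rowNormSum N) ≤ ∑ i, √(norm1 (Pi.single i 1 ᵥ* N)) := by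
  have hadd : ∀ a b : ℝ, 0 ≤ a → 0 ≤ b → √(a + b) ≤ √a + √b := fun a b ha hb =>
    Real.sqrt_le_iff.2 ⟨by positivity, by
      nlinarith [Real.sq_sqrt ha, Real.sq_sqrt hb,
        mul_nonneg (Real.sqrt_nonneg a) (Real.sqrt_nonneg b)]⟩
  have key : ∀ s : Finset (Fin m), √(∑ i ∈ s, norm1 (N i)) ≤ ∑ i ∈ s, √(norm1 (N i)) := by
    classical
    intro s
    induction s using Finset.induction_on with
    | empty => simp
    | insert i s hi ih =>
      rw [Finset.sum_insert hi, Finset.sum_insert hi]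
      have := hadd _ _ (norm1_nonneg (N i))
        (Finset.sum_nonneg (s := s) fun i _ => norm1_nonneg (N i))
      linarith
  simp only [Matrix.single_one_vecMul]
  exact key Finset.univ

/-- Without conservative vectors, the mean of `ln ‖M_u‖` over the words of some length is
negative: `ln t ≤ 2 (√t - 1)` bounds it by a square-root moment, which tends to `0`. -/
theorem exists_sum_log_rowNormSum_neg [Fintype A] [Nonempty A] [NeZero m]
    {M : A → Matrix (Fin m) (Fin m) ℝ} (hM : IsNonneg M) (hfair : IsSuperfair M)
    (hcons : ∀ v : Fin m → ℝ, 0 ≤ v → v ≠ 0 → ¬ IsConservative M v)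
    (hpos : ∀ u, 0 < rowNormSum (wordMat M u)) :
    ∃ L : ℕ, 0 < L ∧
      ∑ f : Fin L → A, Real.log (rowNormSum (wordMat M (List.ofFn f))) < 0 := by
  obtain ⟨n, c, hc0, hc1, hc⟩ := exists_sqrtMean_le_mul_sqrt hM hfair hcons
  have hm : (0 : ℝ) < m := by exact_mod_cast Nat.pos_of_neZero m
  obtain ⟨k, hk⟩ := exists_pow_lt_of_lt_one (inv_pos.2 hm) hc1
  have hA : (0 : ℝ) < Fintype.card A := by exact_mod_cast Fintype.card_pos
  have hsingle : ∀ i : Fin m, 0 ≤ (Pi.single i 1 : Fin m → ℝ) ∧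
      norm1 (Pi.single i 1 : Fin m → ℝ) = 1 := fun i =>
    mem_stdSimplex_iff.1 (single_mem_stdSimplex ℝ i)
  have hsum : ∑ i : Fin m, sqrtMean M (k * n) (Pi.single i 1) < 1 := by
    calc ∑ i : Fin m, sqrtMean M (k * n) (Pi.single i 1) ≤ ∑ _i : Fin m, c ^ k :=
          Finset.sum_le_sum fun i _ => by
            have := sqrtMean_mul_le_pow hM hc0 hc k (hsingle i).1
            rwa [(hsingle i).2, Real.sqrt_one, mul_one] at this
      _ = m * c ^ k := by simp
      _ < m * (m : ℝ)⁻¹ := mul_lt_mul_of_pos_left hk hm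
      _ = 1 := mul_inv_cancel₀ hm.ne'
  refine ⟨k * n, Nat.pos_of_ne_zero fun h => ?_, ?_⟩
  · rw [h] at hsum
    simp only [sqrtMean, (hsingle _).2, Real.sqrt_one, Finset.sum_const, Finset.card_univ,
      Fintype.card_fin, nsmul_eq_mul, mul_one] at hsum
    have : (1 : ℝ) ≤ m := by exact_mod_cast Nat.pos_of_neZero m
    linarith
  · have hroot : ∑ f : Fin (k * n) → A, √(rowNormSum (wordMat M (List.ofFn f)))
        < (Fintype.card A : ℝ) ^ (k * n) := by
      calc ∑ f : Fin (k * n) → A, √(rowNormSum (wordMat M (List.ofFn f)))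
          ≤ ∑ f : Fin (k * n) → A, ∑ i,
              √(norm1 (Pi.single i 1 ᵥ* wordMat M (List.ofFn f))) :=
            Finset.sum_le_sum fun f _ => sqrt_rowNormSum_le _
        _ = (∑ i : Fin m, sqrtMean M (k * n) (Pi.single i 1))
              * (Fintype.card A : ℝ) ^ (k * n) := by
            rw [Finset.sum_comm, Finset.sum_mul]
            refine Finset.sum_congr rfl fun i _ => ?_
            rw [sqrtMean_eq_sum, div_mul_cancel₀ _ (pow_pos hA _).ne']
        _ < _ := mul_lt_of_lt_one_left (pow_pos hA _) hsum
    have hlog : ∀ f : Fin (k * n) → A, Real.log (rowNormSum (wordMat M (List.ofFn f)))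
        ≤ 2 * √(rowNormSum (wordMat M (List.ofFn f))) - 2 := fun f => by
      have h1 := Real.log_le_sub_one_of_pos (Real.sqrt_pos.2 (hpos (List.ofFn f)))
      rw [Real.log_sqrt (hpos _).le] at h1
      linarith
    refine (Finset.sum_le_sum fun f _ => hlog f).trans_lt ?_
    rw [Finset.sum_sub_distrib, ← Finset.mul_sum]
    simp only [Finset.sum_const, Finset.card_univ, Fintype.card_fun, Fintype.card_fin,
      nsmul_eq_mul, Nat.cast_pow]
    linarith

/-! ### Block averages along normal sequences -/

lemma IsNormal.tendsto_average [Fintype A] {X : ℕ → A} (hX : IsNormal X) (L : ℕ)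
    (g : List A → ℝ) :
    Tendsto (fun N : ℕ => (∑ i ∈ Finset.range N, g (subword X i L)) / N) atTop
      (𝓝 ((∑ f : Fin L → A, g (List.ofFn f)) / (Fintype.card A : ℝ) ^ L)) := by
  classical
  have hterm : ∀ f : Fin L → A, Tendsto (fun N : ℕ =>
      (((Finset.range N).filter fun i => (fun j : Fin L => X (i + j)) = f).card : ℝ) / N
        * g (List.ofFn f)) atTop
      (𝓝 (1 / (Fintype.card A : ℝ) ^ L * g (List.ofFn f))) := fun f => by
    have h := hX (List.ofFn f)
    rw [List.length_ofFn] at h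
    simp only [subword, List.ofFn_inj] at h
    refine Tendsto.mul_const _ ?_
    convert h
  have hsum := tendsto_finsetSum Finset.univ fun f _ => hterm f
  have hlim : ∑ f : Fin L → A, 1 / (Fintype.card A : ℝ) ^ L * g (List.ofFn f)
      = (∑ f : Fin L → A, g (List.ofFn f)) / (Fintype.card A : ℝ) ^ L := by
    rw [← Finset.mul_sum, one_div, inv_mul_eq_div]
  rw [hlim] at hsum
  refine hsum.congr fun N => ?_
  rw [← Finset.sum_fiberwise (Finset.range N) (fun i => fun j : Fin L => X (i + j)),
    Finset.sum_div]
  refine Finset.sum_congr rfl fun f _ => ?_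
  rw [Finset.sum_congr rfl (g := fun _ => g (List.ofFn f)) (fun i hi => by
    rw [subword, (Finset.mem_filter.1 hi).2]), Finset.sum_const, nsmul_eq_mul]
  ring

/-- A sequence whose increments over `L` steps are bounded by a sequence with negative mean, and
whose one-step increments are bounded, has a negative drift. -/
lemma exists_eventually_le_of_average_neg {s g : ℕ → ℝ} {L : ℕ} (hL : 0 < L) {D γ : ℝ}
    (hD : 0 ≤ D) (hg : ∀ n, s (n + L) ≤ s n + g n) (hs : ∀ n, s (n + 1) ≤ s n + D)
    (hγ : γ < 0)
    (hlim : Tendsto (fun N : ℕ => (∑ i ∈ Finset.range N, g i) / N) atTop (𝓝 γ)) :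
    ∃ α : ℝ, 0 < α ∧ ∃ C : ℝ, ∀ᶠ n : ℕ in atTop, s n ≤ C - α * n := by
  have hL' : (0 : ℝ) < L := by exact_mod_cast hL
  have hstep : ∀ n j, s (n + j) ≤ s n + j * D := fun n j => by
    induction j with
    | zero => simp
    | succ j ih =>
      have := hs (n + j)
      rw [← add_assoc]
      push_cast
      linarith
  -- summing the bounds on the increments telescopes up to `L` boundary terms
  have htel : ∀ N, L * s (N + L)
      ≤ ∑ j ∈ Finset.range L, s j + ∑ i ∈ Finset.range N, g i + L * (L * D) := fun N => by
    have h1 : ∑ i ∈ Finset.range N, s (L + i)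
        ≤ ∑ i ∈ Finset.range N, s i + ∑ i ∈ Finset.range N, g i := by
      rw [← Finset.sum_add_distrib]
      exact Finset.sum_le_sum fun i _ => by rw [add_comm L i]; exact hg i
    have h2 : ∑ j ∈ Finset.range L, s j + ∑ i ∈ Finset.range N, s (L + i)
        = ∑ i ∈ Finset.range N, s i + ∑ j ∈ Finset.range L, s (N + j) := by
      rw [← Finset.sum_range_add, ← Finset.sum_range_add, add_comm]
    have h3 : ∑ _j ∈ Finset.range L, s (N + L)
        ≤ ∑ j ∈ Finset.range L, (s (N + j) + L * D) := by
      refine Finset.sum_le_sum fun j hj => ?_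
      have hj' : j ≤ L := (Finset.mem_range.1 hj).le
      have h := hstep (N + j) (L - j)
      rw [add_assoc, Nat.add_sub_cancel' hj'] at h
      have hle : ((L - j : ℕ) : ℝ) ≤ L := by exact_mod_cast Nat.sub_le L j
      have := mul_le_mul_of_nonneg_right hle hD
      linarith
    rw [Finset.sum_add_distrib] at h3
    simp only [Finset.sum_const, Finset.card_range, nsmul_eq_mul] at h3
    linarith
  have hev : ∀ᶠ N : ℕ in atTop, ∑ i ∈ Finset.range N, g i ≤ γ / 2 * N := by
    filter_upwards [hlim.eventually_lt_const (show γ < γ / 2 by linarith), eventually_gt_atTop 0]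
      with N hN hN0
    have hN0' : (0 : ℝ) < N := by exact_mod_cast hN0
    exact ((div_lt_iff₀ hN0').1 hN).le
  refine ⟨-γ / (2 * L), div_pos (neg_pos.2 hγ) (by positivity),
    (∑ j ∈ Finset.range L, s j + L * (L * D)) / L + -γ / (2 * L) * L, ?_⟩
  filter_upwards [(tendsto_sub_atTop_nat L).eventually hev, eventually_ge_atTop L] with n hn hnL
  have h := htel (n - L)
  rw [Nat.sub_add_cancel hnL] at h
  rw [Nat.cast_sub hnL] at hn
  refine le_of_mul_le_mul_left ?_ hL'
  field_simp
  linarith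

/-! ### Decay of orbits -/

lemma subword_add (X : ℕ → A) (n L : ℕ) : subword X 0 (n + L) = subword X 0 n ++ subword X n L := by
  simp [subword, List.ofFn_add]

lemma orbit_add (M : A → Matrix (Fin m) (Fin m) ℝ) (X : ℕ → A) (v : Fin m → ℝ) (n L : ℕ) :
    orbit M X v (n + L) = orbit M X v n ᵥ* wordMat M (subword X n L) := by
  rw [orbit, subword_add, vecMul_wordMat_append, orbit]

/-- If the mean of `ln ‖M_u‖` over the words of some length is negative, every orbit that avoids
`0` along a normal sequence decays exponentially fast. -/
lemma convergesExpFast_orbit [Fintype A] [Nonempty A] {M : A → Matrix (Fin m) (Fin m) ℝ}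
    (hM : IsNonneg M) (hfair : IsSuperfair M) (hpos : ∀ u, 0 < rowNormSum (wordMat M u)) {L : ℕ}
    (hL : 0 < L) (hneg : ∑ f : Fin L → A, Real.log (rowNormSum (wordMat M (List.ofFn f))) < 0)
    {X : ℕ → A} (hX : IsNormal X) {v : Fin m → ℝ} (hv : 0 ≤ v)
    (horb : ∀ n, 0 < norm1 (orbit M X v n)) :
    ConvergesExpFast (fun n => norm1 (orbit M X v n)) 0 := by
  have hA : (0 : ℝ) < Fintype.card A := by exact_mod_cast Fintype.card_pos
  have hA1 : (1 : ℝ) ≤ Fintype.card A := by exact_mod_cast Fintype.card_pos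
  have horb0 : ∀ n, 0 ≤ orbit M X v n := fun n => vecMul_wordMat_nonneg hM hv _
  obtain ⟨α, hα, C, hC⟩ := exists_eventually_le_of_average_neg hL (Real.log_nonneg hA1)
    (s := fun n => Real.log (norm1 (orbit M X v n)))
    (g := fun i => Real.log (rowNormSum (wordMat M (subword X i L))))
    (fun n => by
      rw [← Real.log_mul (horb n).ne' (hpos _).ne', orbit_add]
      exact Real.log_le_log (orbit_add M X v n L ▸ horb (n + L)) (norm1_vecMul_le _ _))
    (fun n => by
      rw [← Real.log_mul (horb n).ne' hA.ne']
      refine Real.log_le_log (horb (n + 1)) ?_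
      -- one of the images is bounded by the sum of all of them
      rw [orbit_add, show subword X n 1 = [X n] by simp [subword], wordMat_singleton, mul_comm]
      exact (Finset.single_le_sum (f := fun a => norm1 (orbit M X v n ᵥ* M a))
        (fun _ _ => norm1_nonneg _) (Finset.mem_univ (X n))).trans (hfair.sum_le (horb0 n)))
    (div_neg_of_neg_of_pos hneg (pow_pos hA L))
    (hX.tendsto_average L fun u => Real.log (rowNormSum (wordMat M u)))
  refine ⟨α, hα, IsBigO.of_bound (Real.exp C) ?_⟩
  filter_upwards [hC] with n hn
  rw [sub_zero, Real.norm_of_nonneg (norm1_nonneg _), Real.norm_of_nonneg (Real.exp_pos _).le,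
    ← Real.exp_add, ← Real.log_le_iff_le_exp (horb n)]
  linarith

end MatFam

theorem mainTheorem4 {A : Type*} [Fintype A] [Nonempty A] {m : ℕ}
    (M : A → Matrix (Fin m) (Fin m) ℝ) (hM : IsNonneg M) (hfair : IsSuperfair M)
    (hstar : IsStar M)
    (B : Set (Set (Fin m))) (hB : IsNonNullBSCC M B)
    (F : Set (Fin m)) (hF : F ∈ B)
    (w : List A) (hw : PseudoMixes M w F)
    (x : Fin m → ℝ) (hx : IsFixedDirection M F w x)
    (hrisk : ∃ z : List A, 0 < risk M (dirAct M x z)) :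
    (∀ X : ℕ → A, IsNormal X → ∀ v : Fin m → ℝ, 0 ≤ v →
      (∀ᶠ n in atTop, orbit M X v n = 0) ∨
        ((∀ n, 0 < norm1 (orbit M X v n)) ∧
          ConvergesExpFast (fun n => norm1 (orbit M X v n)) 0)) ∧
    ∃ v : Fin m → ℝ, 0 ≤ v ∧ ∀ X : ℕ → A, IsNormal X →
      (∀ n, 0 < norm1 (orbit M X v n)) ∧
        ConvergesExpFast (fun n => norm1 (orbit M X v n)) 0 := by
  obtain ⟨z, hz⟩ := hrisk
  have hx0 : 0 ≤ x := hx.1.1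
  have hxpos : ∀ u, 0 < norm1 (x ᵥ* wordMat M u) := fun u =>
    norm1_pos (vecMul_wordMat_ne_zero hM hB hx0 (hx.1.2.2 ▸ hF) u)
  have : NeZero m := ⟨by
    rintro rfl
    simpa [norm1] using hxpos []⟩
  have hpos : ∀ u, 0 < rowNormSum (wordMat M u) := fun u =>
    pos_of_mul_pos_right ((hxpos u).trans_le (norm1_vecMul_le x _)) (norm1_nonneg x)
  obtain ⟨L, hL, hneg⟩ := exists_sum_log_rowNormSum_neg hM hfair
    (fun v hv hv0 => not_isConservative_of_risk_pos hM hfair hstar hB hF hw hx hz hv hv0) hpos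
  refine ⟨fun X hX v hv => ?_, x, hx0, fun X hX =>
    ⟨fun n => hxpos _, convergesExpFast_orbit hM hfair hpos hL hneg hX hx0 fun n => hxpos _⟩⟩
  by_cases h : ∃ n, orbit M X v n = 0
  · obtain ⟨n, hn⟩ := h
    refine Or.inl (eventually_atTop.2 ⟨n, fun k hk => ?_⟩)
    obtain ⟨l, rfl⟩ := Nat.exists_eq_add_of_le hk
    rw [orbit_add, hn, Matrix.zero_vecMul]
  · push Not at h
    have horb : ∀ n, 0 < norm1 (orbit M X v n) := fun n => norm1_pos (h n)
    exact Or.inr ⟨horb, convergesExpFast_orbit hM hfair hpos hL hneg hX hv horb⟩
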